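/- Let $\mathbb{A}=\mathbb{A}_{\mathbb{Q}}^{fin}$ be the ring of finite adeles of $\mathbb{Q}$, i.e. the restricted product of the fields $\mathbb{Q}_p$ with respect to the subrings $\mathbb{Z}_p$ over all primes $p$, regarded as a structure in the language of rings. Let $\Gamma$ be its value monoid, i.e. the set of all $g\in\prod_p(\mathbb{Z}\cup\{\infty\})$ with $g(p)\ge 0$ for all but finitely many $p$, regarded as a structure in the language $\{+,\wedge,\vee,0,\infty\}$ of lattice-ordered monoids, where all operations are taken coordinatewise ($\wedge=\min$, $\vee=\max$). Let $v:\mathbb{A}\to\Gamma$, $v(x)=(v_p(x_p))_p$, be the product valuation, where $v_p$ is the normalized $p$-adic valuation and $v_p(0)=\infty$. Throughout, "definable" means definable by a first-order formula without parameters. Theorem. The value monoid $\Gamma$ is not stably interpreted in $\mathbb{A}$ via $v$; that is, for some $n$ there is a subset $D\subseteq\Gamma^n$ whose preimage in $\mathbb{A}^n$ under $v$ is definable in the ring $\mathbb{A}$ while $D$ is not definable in $\Gamma$. Moreover, let $X$ be the set of idempotents of $\mathbb{A}$ whose support is the set of primes $p\equiv 1 \pmod 4$. Then $X$ is definable in the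 ring $\mathbb{A}$, its image $v(X)$ is the set $Y$ of all $g\in\Gamma$ with $g(p)=0$ for $p\equiv 1\pmod 4$ and $g(p)=\infty$ for all other $p$, and $Y$ is not definable in $\Gamma$. -/

import Mathlib

open FirstOrder Filter
open scoped RestrictedProduct

noncomputable section

instance Nat.Primes.factPrime (p : Nat.Primes) : Fact (Nat.Prime (p : ℕ)) := ⟨p.2⟩

/-- The ring of finite adeles of `ℚ`: the restricted product of the fields `ℚ_p` with respect to
the subrings `ℤ_p`, over all primes `p`. -/
abbrev FinAdelesQ : Type :=
  Πʳ p : Nat.Primes, [ℚ_[(p : ℕ)], PadicInt.subring (p : ℕ)]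

/-- The finite adeles as a first-order structure in the language of rings. -/
instance FinAdelesQ.compatibleRing : FirstOrder.Ring.CompatibleRing FinAdelesQ :=
  FirstOrder.Ring.compatibleRingOfRing FinAdelesQ

/-- The value monoid: the restricted product, over all primes, of the lattice-ordered monoids
`ℤ ∪ {∞}` with respect to the condition `0 ≤ g`, that is, the set of all `g : ∏ p, ℤ ∪ {∞}` such
that `0 ≤ g p` for all but finitely many `p`. -/
def ValueMonoid : Type :=
  Πʳ _p : Nat.Primes, [WithTop ℤ, Set.Ici (0 : WithTop ℤ)]

namespace ValueMonoid

instance : DFunLike ValueMonoid Nat.Primes (fun _ => WithTop ℤ) :=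
  inferInstanceAs (DFunLike (Πʳ _p : Nat.Primes, [WithTop ℤ, Set.Ici (0 : WithTop ℤ)])
    Nat.Primes (fun _ => WithTop ℤ))

/-- An element of the value monoid, from its coordinates. -/
def mk (g : Nat.Primes → WithTop ℤ) (hg : ∀ᶠ p in cofinite, 0 ≤ g p) : ValueMonoid :=
  ⟨g, hg⟩

@[simp]
theorem mk_apply (g : Nat.Primes → WithTop ℤ) (hg : ∀ᶠ p in cofinite, 0 ≤ g p)
    (p : Nat.Primes) : mk g hg p = g p := rfl

@[ext]
theorem ext {g h : ValueMonoid} (H : ∀ p, g p = h p) : g = h := DFunLike.ext g h H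

theorem eventually_nonneg (g : ValueMonoid) : ∀ᶠ p in cofinite, 0 ≤ g p := g.2

/-- Coordinatewise addition. -/
def add (g h : ValueMonoid) : ValueMonoid :=
  mk (fun p => g p + h p) <| by
    filter_upwards [g.eventually_nonneg, h.eventually_nonneg] with p hg hh
    exact add_nonneg hg hh

/-- Coordinatewise minimum. -/
def inf (g h : ValueMonoid) : ValueMonoid :=
  mk (fun p => min (g p) (h p)) <| by
    filter_upwards [g.eventually_nonneg, h.eventually_nonneg] with p hg hh
    exact le_min hg hh

/-- Coordinatewise maximum. -/
def sup (g h : ValueMonoid) : ValueMonoid :=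
  mk (fun p => max (g p) (h p)) <| by
    filter_upwards [g.eventually_nonneg] with p hg
    exact le_max_of_le_left hg

/-- The constant `0`. -/
def zero : ValueMonoid := mk (fun _ => 0) (Eventually.of_forall fun _ => le_rfl)

/-- The constant `∞`. -/
def top : ValueMonoid := mk (fun _ => ⊤) (Eventually.of_forall fun _ => le_top)

end ValueMonoid

/-- The function symbols `+`, `∧`, `∨`, `0`, `∞` of lattice-ordered monoids with `∞`. -/
inductive LatMonFunc : ℕ → Type
  | add : LatMonFunc 2
  | inf : LatMonFunc 2
  | sup : LatMonFunc 2
  | zero : LatMonFunc 0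
  | top : LatMonFunc 0

/-- The language `{+, ∧, ∨, 0, ∞}` of lattice-ordered monoids with `∞`. -/
def latMonLanguage : Language :=
  { Functions := LatMonFunc
    Relations := fun _ => Empty }

/-- The value monoid as a first-order structure in the language `{+, ∧, ∨, 0, ∞}`. -/
instance ValueMonoid.latMonStructure : latMonLanguage.Structure ValueMonoid where
  funMap := fun {n} f =>
    match n, f with
    | _, .add => fun x => ValueMonoid.add (x 0) (x 1)
    | _, .inf => fun x => ValueMonoid.inf (x 0) (x 1)
    | _, .sup => fun x => ValueMonoid.sup (x 0) (x 1)
    | _, .zero => fun _ => ValueMonoid.zero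
    | _, .top => fun _ => ValueMonoid.top
  RelMap := fun r => nomatch r

theorem FinAdelesQ.addValuation_nonneg (x : FinAdelesQ) :
    ∀ᶠ p : Nat.Primes in cofinite, 0 ≤ Padic.addValuation (x p) := by
  have hx : ∀ᶠ p : Nat.Primes in cofinite, x p ∈ PadicInt.subring (p : ℕ) := x.2
  filter_upwards [hx] with p hp
  by_cases h : x p = 0
  · simp [h]
  · rw [Padic.addValuation.apply h]
    exact_mod_cast (Padic.norm_le_one_iff_val_nonneg (x p)).1 hp

/-- The product valuation `x ↦ (v_p(x_p))_p` from the finite adeles to the value monoid, where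
`v_p` is the normalized `p`-adic valuation, with `v_p(0) = ∞`. -/
def productValuation (x : FinAdelesQ) : ValueMonoid :=
  ValueMonoid.mk (fun p => Padic.addValuation (x p)) x.addValuation_nonneg

/-- Let `π : M → N` be the map through which an `L'`-structure `N` is interpreted in an
`L`-structure `M`. Then `N` is *stably interpreted* in `M` via `π` if `M` induces no new definable
sets on `N`: every subset `D` of a finite power of `N` that is definable in `M` (that is, whose
preimage under `π` is definable in `M`) is definable in `N` itself. Definable means definable
without parameters on both sides. -/
def StablyInterpreted (L L' : Language) {M N : Type} [L.Structure M] [L'.Structure N]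
    (π : M → N) : Prop :=
  ∀ (n : ℕ) (D : Set (Fin n → N)),
    (∅ : Set M).Definable L {x : Fin n → M | (fun i => π (x i)) ∈ D} →
      (∅ : Set N).Definable L' D

/-- The idempotent finite adeles whose support is the set of primes `p ≡ 1 mod 4`. -/
def idempotentsOneModFour : Set FinAdelesQ :=
  {e | IsIdempotentElem e ∧ ∀ p : Nat.Primes, e p ≠ 0 ↔ (p : ℕ) % 4 = 1}

/-- The set of all `g` in the value monoid that are `0` at the primes `p ≡ 1 mod 4` and `∞`
elsewhere. -/
def zeroOneModFour : Set ValueMonoid :=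
  {g | ∀ p : Nat.Primes, g p = if (p : ℕ) % 4 = 1 then 0 else ⊤}

end

/-! ### Square roots of `-1` in the `p`-adic numbers -/

/-! Permuting the primes gives automorphisms of `Γ`, so a parameter-free definable set in `Γ` cannot
tell one prime from another. The ring `𝔸` can: `-1` is a square in `ℚ_p` exactly when `p ≡ 1 mod 4`,
so the idempotent `e` supported on these primes is the greatest idempotent whose negative is a
square. Hence `X = {e}` is definable, while a transposition of primes moves the single point of `Y`.
Stable interpretation is refuted with a larger set than `Y`: the `g` that are finite exactly at the
primes `p ≡ 1 mod 4`. Its preimage consists of the adeles with the same annihilator as `e`, so the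
valuation need not be defined in the ring. -/

/-- Hensel's lemma for `X ^ 2 + 1` at a lift `a` of a root mod `p`; the derivative `2 * a` is a unit
because `p` is odd and `a` is nonzero mod `p`. -/
theorem Padic.exists_sq_eq_neg_one {p : ℕ} [Fact p.Prime] (hp : p % 4 = 1) :
    ∃ z : ℤ_[p], z ^ 2 = -1 := by
  obtain ⟨b, hb⟩ := (ZMod.exists_sq_eq_neg_one_iff (p := p)).2 (by omega)
  obtain ⟨a, rfl⟩ := ZMod.ringHom_surjective (PadicInt.toZMod (p := p)) b
  have hker : PadicInt.toZMod (a ^ 2 + 1) = 0 := by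
    rw [map_add, map_pow, map_one, sq, ← hb, neg_add_cancel]
  have hlt {x : ℤ_[p]} : PadicInt.toZMod x = 0 ↔ ‖x‖ < 1 := by
    rw [← RingHom.mem_ker, PadicInt.ker_toZMod, IsLocalRing.mem_maximalIdeal,
      PadicInt.mem_nonunits]
  have h2 : PadicInt.toZMod (2 * a) ≠ 0 := by
    intro h
    rw [map_mul, mul_eq_zero] at h
    rcases h with h | h
    · have h' : ((2 : ℕ) : ZMod p) = 0 := by rw [← h]; exact_mod_cast (map_natCast PadicInt.toZMod 2).symm
      rw [ZMod.natCast_eq_zero_iff] at h'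
      rw [Nat.prime_dvd_prime_iff_eq Fact.out Nat.prime_two] at h'
      omega
    · rw [h] at hb
      simp at hb
  have hn : ‖2 * a‖ = 1 :=
    le_antisymm (PadicInt.norm_le_one _) (not_lt.1 fun h => h2 (hlt.2 h))
  obtain ⟨z, hz, -⟩ := hensels_lemma (p := p) (R := ℤ) (F := Polynomial.X ^ 2 + 1) (a := a) (by
    have : (Polynomial.derivative (Polynomial.X ^ 2 + 1 : Polynomial ℤ)).aeval a = 2 * a := by
      simp [map_ofNat]
    rw [this, hn]
    simpa using hlt.1 hker)
  exact ⟨z, eq_neg_of_add_eq_zero_left (by simpa using hz)⟩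

/-- A root is integral, so it can be reduced: mod `p` this excludes `p ≡ 3 mod 4`, and mod `4` it
excludes `p = 2`. -/
theorem Padic.mod_four_eq_one_of_sq_eq_neg_one {p : ℕ} [hp : Fact p.Prime] {y : ℚ_[p]}
    (hy : y ^ 2 = -1) : p % 4 = 1 := by
  have hn : ‖y‖ ≤ 1 := by
    have h : ‖y‖ ^ 2 = 1 := by rw [← norm_pow, hy, norm_neg, norm_one]
    exact (pow_le_one_iff_of_nonneg (norm_nonneg y) two_ne_zero).1 h.le
  obtain ⟨z, rfl⟩ : ∃ z : ℤ_[p], (z : ℚ_[p]) = y := ⟨⟨y, hn⟩, rfl⟩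
  have hz : z ^ 2 = -1 := PadicInt.ext (by simpa using hy)
  have h3 : p % 4 ≠ 3 := ZMod.exists_sq_eq_neg_one_iff.1
    ⟨PadicInt.toZMod z, by rw [← sq, ← map_pow, hz, map_neg, map_one]⟩
  rcases hp.out.eq_two_or_odd with rfl | hodd
  · have h := congrArg (PadicInt.toZModPow (p := 2) 2) hz
    rw [map_pow, map_neg, map_one] at h
    exact absurd h ((by decide : ∀ b : ZMod (2 ^ 2), b ^ 2 ≠ -1) _)
  · omega

/-! ### Idempotents of the finite adeles -/

namespace FinAdelesQ

theorem isIdempotentElem_apply {e : FinAdelesQ} (he : IsIdempotentElem e) (p : Nat.Primes) :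
    e p = 0 ∨ e p = 1 := by
  have h : e p * e p = e p := congrArg (fun x : FinAdelesQ => x p) he
  exact IsIdempotentElem.iff_eq_zero_or_one.1 h

/-- The finite adele given by a family of `p`-adic integers. -/
noncomputable def ofIntegers (f : ∀ p : Nat.Primes, ℤ_[(p : ℕ)]) : FinAdelesQ :=
  ⟨fun p => f p, Eventually.of_forall fun p => (f p).2⟩

@[simp]
theorem ofIntegers_apply (f : ∀ p : Nat.Primes, ℤ_[(p : ℕ)]) (p : Nat.Primes) :
    ofIntegers f p = f p := rfl

/-- The idempotent whose support is the set of primes `p ≡ 1 mod 4`. -/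
noncomputable def idempotentOneModFour : FinAdelesQ :=
  ofIntegers fun p => if (p : ℕ) % 4 = 1 then 1 else 0

theorem idempotentOneModFour_apply (p : Nat.Primes) :
    idempotentOneModFour p = if (p : ℕ) % 4 = 1 then 1 else 0 := by
  rw [idempotentOneModFour, ofIntegers_apply]
  split_ifs <;> simp

theorem isIdempotentElem_idempotentOneModFour : IsIdempotentElem idempotentOneModFour := by
  refine RestrictedProduct.ext _ _ fun p => ?_
  rw [RestrictedProduct.mul_apply, idempotentOneModFour_apply]
  split_ifs <;> simp

theorem idempotentsOneModFour_eq : idempotentsOneModFour = {idempotentOneModFour} := by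
  ext e
  refine ⟨fun ⟨he, h⟩ => RestrictedProduct.ext _ _ fun p => ?_, ?_⟩
  · rw [idempotentOneModFour_apply]
    split_ifs with hp
    · exact (isIdempotentElem_apply he p).resolve_left ((h p).2 hp)
    · exact not_not.1 (mt (h p).1 hp)
  · rintro rfl
    refine ⟨isIdempotentElem_idempotentOneModFour, fun p => ?_⟩
    rw [idempotentOneModFour_apply]
    split_ifs with hp <;> simp [hp]

theorem exists_mul_self_eq_neg_idempotentOneModFour :
    ∃ y : FinAdelesQ, y * y = -idempotentOneModFour := by
  have h (p : Nat.Primes) :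
      ∃ z : ℤ_[(p : ℕ)], z * z = -(if (p : ℕ) % 4 = 1 then 1 else 0) := by
    split_ifs with hp
    · obtain ⟨z, hz⟩ := Padic.exists_sq_eq_neg_one hp
      exact ⟨z, by rw [← sq, hz]⟩
    · exact ⟨0, by simp⟩
  choose z hz using h
  refine ⟨ofIntegers z, RestrictedProduct.ext _ _ fun p => ?_⟩
  rw [RestrictedProduct.mul_apply, RestrictedProduct.neg_apply, idempotentOneModFour,
    ofIntegers_apply, ofIntegers_apply]
  exact_mod_cast congrArg (Subtype.val) (hz p)

theorem mul_idempotentOneModFour {f y : FinAdelesQ} (hf : f * f = f) (hy : y * y = -f) :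
    f * idempotentOneModFour = f := by
  refine RestrictedProduct.ext _ _ fun p => ?_
  rw [RestrictedProduct.mul_apply, idempotentOneModFour_apply]
  rcases isIdempotentElem_apply hf p with h | h
  · simp [h]
  · have hyp : y p * y p = -f p := congrArg (fun x : FinAdelesQ => x p) hy
    rw [h, ← sq] at hyp
    rw [if_pos (Padic.mod_four_eq_one_of_sq_eq_neg_one hyp), mul_one]

/-- The adele `idempotentOneModFour` is the greatest idempotent whose negative is a square. -/
theorem eq_idempotentOneModFour_iff {e : FinAdelesQ} :
    e = idempotentOneModFour ↔ (e * e = e ∧ ∃ y, y * y = -e) ∧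
      ∀ f : FinAdelesQ, f * f = f → (∃ y, y * y = -f) → f * e = f := by
  constructor
  · rintro rfl
    exact ⟨⟨isIdempotentElem_idempotentOneModFour, exists_mul_self_eq_neg_idempotentOneModFour⟩,
      fun f hf ⟨y, hy⟩ => mul_idempotentOneModFour hf hy⟩
  · rintro ⟨⟨he, y, hy⟩, h⟩
    -- Antisymmetry of the order on idempotents, where `f ≤ e` means `f * e = f`.
    rw [← mul_idempotentOneModFour he hy, mul_comm]
    exact (h _ isIdempotentElem_idempotentOneModFour
      exists_mul_self_eq_neg_idempotentOneModFour).symm ▸ rfl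

/-- An adele is nonzero exactly at the primes `p ≡ 1 mod 4` if and only if it has the same
annihilator as `idempotentOneModFour`. -/
theorem forall_ne_zero_iff {x : FinAdelesQ} :
    (∀ p : Nat.Primes, x p ≠ 0 ↔ (p : ℕ) % 4 = 1) ↔
      ∀ y, x * y = 0 ↔ idempotentOneModFour * y = 0 := by
  have hmul (z y : FinAdelesQ) : z * y = 0 ↔ ∀ p, z p = 0 ∨ y p = 0 := by
    refine ⟨fun h p => mul_eq_zero.1 (congrArg (fun x : FinAdelesQ => x p) h), fun h => ?_⟩
    exact RestrictedProduct.ext _ _ fun p => mul_eq_zero.2 (h p)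
  have he (p : Nat.Primes) : idempotentOneModFour p = 0 ↔ ¬ (p : ℕ) % 4 = 1 := by
    rw [idempotentOneModFour_apply]
    split_ifs with hp <;> simp [hp]
  simp only [hmul, he]
  refine ⟨fun h y => forall_congr' fun p => by rw [← h p, not_not], fun h p => ?_⟩
  -- Testing annihilators on the adele that is `1` at `p` and `0` elsewhere isolates the coordinate
  -- `p`.
  have hs (q : Nat.Primes) : ofIntegers (Pi.single p 1) q = 0 ↔ q ≠ p := by
    rcases eq_or_ne q p with rfl | hq
    · simp
    · simp [hq]
  have := h (ofIntegers (Pi.single p 1))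
  simp only [hs] at this
  have hor (P : Nat.Primes → Prop) : (∀ q, P q ∨ q ≠ p) ↔ P p :=
    ⟨fun h => (h p).resolve_right (not_not.2 rfl), fun h q => by
      rcases eq_or_ne q p with rfl | hq
      exacts [.inl h, .inr hq]⟩
  rw [hor, hor] at this
  rw [ne_eq, this, not_not]

/-! ### Definability in the ring of finite adeles -/

open Language in
/-- The formula, in the bound variable `0`, saying that it is the greatest idempotent whose
negative is a square. -/
def idempotentFormula : Language.ring.BoundedFormula (Fin 1) 1 :=
  (((&0 * &0) =' &0) ⊓ ∃' ((&1 * &1) =' (-&0))) ⊓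
    ∀' (((&1 * &1) =' &1) ⟹ (∃' ((&2 * &2) =' (-&1))) ⟹ ((&1 * &0) =' &1))

theorem realize_idempotentFormula (v : Fin 1 → FinAdelesQ) (xs : Fin 1 → FinAdelesQ) :
    idempotentFormula.Realize v xs ↔ xs 0 = idempotentOneModFour := by
  rw [eq_idempotentOneModFour_iff]
  simp [idempotentFormula, Fin.snoc]

open Language in
theorem definable_idempotentsOneModFour :
    (∅ : Set FinAdelesQ).Definable₁ Language.ring idempotentsOneModFour := by
  refine Set.empty_definable_iff.2
    ⟨∃' (((&0) =' (Term.var (Sum.inl 0))) ⊓ idempotentFormula), ?_⟩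
  ext x
  rw [idempotentsOneModFour_eq]
  simp [Formula.Realize, realize_idempotentFormula, Fin.snoc]

open Language in
theorem definable_support_oneModFour :
    (∅ : Set FinAdelesQ).Definable Language.ring
      {x : Fin 1 → FinAdelesQ | ∀ p : Nat.Primes, x 0 p ≠ 0 ↔ (p : ℕ) % 4 = 1} := by
  refine Set.empty_definable_iff.2
    ⟨∃' (idempotentFormula ⊓
      ∀' (((Term.var (Sum.inl 0) * &1) =' 0) ⇔ ((&0 * &1) =' 0))), ?_⟩
  ext x
  simp [Formula.Realize, realize_idempotentFormula, Fin.snoc, forall_ne_zero_iff]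

end FinAdelesQ

/-! ### Automorphisms of the value monoid -/

namespace ValueMonoid

/-- The action of a permutation of the primes on the value monoid. -/
def permute (σ : Equiv.Perm Nat.Primes) (g : ValueMonoid) : ValueMonoid :=
  mk (fun p => g (σ p)) (σ.injective.tendsto_cofinite.eventually g.eventually_nonneg)

@[simp]
theorem permute_apply (σ : Equiv.Perm Nat.Primes) (g : ValueMonoid) (p : Nat.Primes) :
    permute σ g p = g (σ p) := rfl

/-- The automorphism of the value monoid given by a permutation of the primes. -/
def permuteEquiv (σ : Equiv.Perm Nat.Primes) : latMonLanguage.Equiv ValueMonoid ValueMonoid where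
  toFun := permute σ
  invFun := permute σ.symm
  left_inv g := by ext p; simp
  right_inv g := by ext p; simp
  map_fun' f x := by cases f <;> rfl
  map_rel' r := nomatch r

theorem permute_mem_iff_of_definable {n : ℕ} {D : Set (Fin n → ValueMonoid)}
    (hD : (∅ : Set ValueMonoid).Definable latMonLanguage D) (σ : Equiv.Perm Nat.Primes)
    (g : Fin n → ValueMonoid) : (fun i => permute σ (g i)) ∈ D ↔ g ∈ D := by
  obtain ⟨φ, rfl⟩ := Set.empty_definable_iff.1 hD
  exact Language.StrongHomClass.realize_formula (permuteEquiv σ) φ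

/-- The element of the value monoid that is `0` at the primes `p ≡ 1 mod 4` and `∞` elsewhere. -/
def oneModFour : ValueMonoid :=
  mk (fun p => if (p : ℕ) % 4 = 1 then 0 else ⊤)
    (Eventually.of_forall fun p => by split_ifs <;> simp)

theorem oneModFour_apply (p : Nat.Primes) :
    oneModFour p = if (p : ℕ) % 4 = 1 then 0 else ⊤ := rfl

theorem zeroOneModFour_eq : zeroOneModFour = {oneModFour} :=
  Set.ext fun _ => ⟨fun h => ext h, fun h p => by rw [h, oneModFour_apply]⟩

/-- A set of elements of the value monoid that contains `oneModFour`, and all of whose elements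
are infinite at the primes `p ≢ 1 mod 4`, is not definable. -/
theorem not_definable {D : Set (Fin 1 → ValueMonoid)} (h : (fun _ => oneModFour) ∈ D)
    (htop : ∀ g ∈ D, ∀ p : Nat.Primes, (p : ℕ) % 4 ≠ 1 → g 0 p = ⊤) :
    ¬ (∅ : Set ValueMonoid).Definable latMonLanguage D := by
  intro hD
  obtain ⟨p, hp⟩ : ∃ p : Nat.Primes, (p : ℕ) % 4 ≠ 1 := ⟨⟨3, Nat.prime_three⟩, by norm_num⟩
  obtain ⟨q, hq⟩ : ∃ q : Nat.Primes, (q : ℕ) % 4 = 1 := ⟨⟨5, Nat.prime_five⟩, by norm_num⟩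
  -- The swap keeps the point in `D` but carries its value `0` at `q` to `p`, where `D` forces `∞`.
  have := htop _ ((permute_mem_iff_of_definable hD (Equiv.swap p q) _).2 h) p hp
  rw [permute_apply, Equiv.swap_apply_left, oneModFour_apply, if_pos hq] at this
  exact WithTop.zero_ne_top this

end ValueMonoid

/-! ### Transfer along the product valuation -/

theorem productValuation_apply_ne_top_iff (x : FinAdelesQ) (p : Nat.Primes) :
    productValuation x p ≠ ⊤ ↔ x p ≠ 0 :=
  (AddValuation.top_iff (Padic.addValuation (p := p))).not

theorem productValuation_idempotentOneModFour :
    productValuation FinAdelesQ.idempotentOneModFour = ValueMonoid.oneModFour := by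
  ext p
  change Padic.addValuation (FinAdelesQ.idempotentOneModFour p) = _
  rw [FinAdelesQ.idempotentOneModFour_apply, ValueMonoid.oneModFour_apply]
  split_ifs
  exacts [AddValuation.map_one _, AddValuation.map_zero _]

theorem mainTheorem9 :
    ¬ StablyInterpreted Language.ring latMonLanguage productValuation ∧
    (∅ : Set FinAdelesQ).Definable₁ Language.ring idempotentsOneModFour ∧
    productValuation '' idempotentsOneModFour = zeroOneModFour ∧
    ¬ (∅ : Set ValueMonoid).Definable₁ latMonLanguage zeroOneModFour := by
  refine ⟨fun h => ?_, FinAdelesQ.definable_idempotentsOneModFour, ?_, ?_⟩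
  · refine ValueMonoid.not_definable
      (D := {g | ∀ p : Nat.Primes, g 0 p ≠ ⊤ ↔ (p : ℕ) % 4 = 1}) (fun p => ?_) (fun g hg p hp => ?_)
      (h 1 _ ?_)
    · rw [ValueMonoid.oneModFour_apply]
      split_ifs with hp <;> simp [hp]
    · exact not_not.1 (mt (hg p).1 hp)
    · simpa only [Set.mem_ofPred_eq, productValuation_apply_ne_top_iff] using
        FinAdelesQ.definable_support_oneModFour
  · rw [FinAdelesQ.idempotentsOneModFour_eq, ValueMonoid.zeroOneModFour_eq, Set.image_singleton,
      productValuation_idempotentOneModFour]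
  · refine ValueMonoid.not_definable ?_ fun g hg p hp => ?_
    · exact fun p => ValueMonoid.oneModFour_apply p
    · exact (hg p).trans (if_neg hp)
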